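/- Let $R$ be a commutative noetherian ring, $J\subset R$ an ideal, and let $\mathcal C$ be an $R$-linear abelian category which is noetherian (essentially small, with all objects noetherian). Let $\operatorname{Pro}(\mathcal C)$ be the category of pro-objects over $\mathcal C$, with its induced $R$-linear structure, and regard $\mathcal C$ as a full subcategory of it. For an ideal $I\subset R$ and an object $M$ of $\mathcal C$ or of $\operatorname{Pro}(\mathcal C)$, write $M/MI=M\otimes_R R/I$. The completion $\widehat{\mathcal C}$ is the full subcategory of $\operatorname{Pro}(\mathcal C)$ consisting of the objects $M$ such that $M/MJ^n\in\mathcal C$ for all $n$ and such that the canonical map $M\to\varprojlim_n M/MJ^n$ is an isomorphism in $\operatorname{Pro}(\mathcal C)$. The category $\check{\mathcal C}$ of $J$-adic inverse systems over $\mathcal C$ is the full subcategory of the category of inverse systems $(N_n,\phi_n)_n$ over $\mathcal C$ consisting of those with $N_nJ^n=0$ for all $n$ and such that each transition map $\phi_n:N_n\to N_{n-1}$ induces an isomorphism $N_n/N_nJ^{n-1}\to N_{n-1}$. Then for every $(N_n)_n$ in $\check{\mathcal C}$ the limit $\varprojlim_n N_n$, taken in $\operatorname{Pro}(\mathcal C)$,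 lies in $\widehat{\mathcal C}$, and the functor $$\Sigma:\widehat{\mathcal C}\to\check{\mathcal C},\qquad M\mapsto (M/MJ^n)_n,$$ is an equivalence of categories, with (quasi-)inverse $$\Psi:\check{\mathcal C}\to\widehat{\mathcal C},\qquad (N_n)_n\mapsto\varprojlim_n N_n.$$ -/

import Mathlib

open CategoryTheory CategoryTheory.Limits Opposite

universe w v u

noncomputable section

namespace JAdic

/-- An ind-object is a left exact presheaf. -/
lemma preservesFiniteLimits_of_isIndObject (D : Type u) [Category.{v} D]
    (A : Dᵒᵖ ⥤ Type v) (hA : IsIndObject A) : PreservesFiniteLimits A := by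
  let P := hA.presentation
  let e : A ≅ (P.F ⋙ yoneda).flip ⋙ colim :=
    P.isColimit.coconePointUniqueUpToIso (colimit.isColimit _) ≪≫
      colimitIsoFlipCompColim (P.F ⋙ yoneda)
  have : PreservesFiniteLimits (P.F ⋙ yoneda).flip :=
    preservesFiniteLimits_of_evaluation _ fun i =>
      inferInstanceAs (PreservesFiniteLimits (yoneda.obj (P.F.obj i)))
  have : PreservesFiniteLimits ((P.F ⋙ yoneda).flip ⋙ colim) := inferInstance
  exact preservesFiniteLimits_of_natIso e.symm

/-- The category of pro-objects over `C`, i.e. the opposite of the category of ind-objects over the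
opposite category: its objects are the formal limits of small filtered inverse systems in `C`, and
`Hom (M_α)_α (N_β)_β = lim_β colim_α Hom M_α N_β`. -/
def Pro (C : Type u) [Category.{v} C] : Type (max u (v + 1)) := (Ind Cᵒᵖ)ᵒᵖ

variable {C : Type u} [Category.{v} C]

instance : Category.{v} (Pro C) := inferInstanceAs (Category.{v} (Ind Cᵒᵖ)ᵒᵖ)

/-- The embedding of `C` into `Pro C`. -/
def Pro.of : C ⥤ Pro C := (Ind.yoneda (C := Cᵒᵖ)).rightOp

instance : (Pro.of (C := C)).Full := inferInstanceAs (Ind.yoneda (C := Cᵒᵖ)).rightOp.Full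
instance : (Pro.of (C := C)).Faithful := inferInstanceAs (Ind.yoneda (C := Cᵒᵖ)).rightOp.Faithful

instance [HasFiniteColimits C] : HasFiniteColimits (Pro C) :=
  inferInstanceAs (HasFiniteColimits (Ind Cᵒᵖ)ᵒᵖ)

instance : HasLimitsOfShape ℕᵒᵖ (Pro C) := by
  have : HasColimitsOfShape (AsSmall.{v} ℕ) (Ind Cᵒᵖ) := inferInstance
  have : HasColimitsOfShape ℕ (Ind Cᵒᵖ) :=
    hasColimitsOfShape_of_equivalence (AsSmall.equiv (C := ℕ)).symm
  have : HasColimitsOfShape ℕᵒᵖᵒᵖ (Ind Cᵒᵖ) :=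
    hasColimitsOfShape_of_equivalence (opOpEquivalence ℕ).symm
  have := hasLimitsOfShape_op_of_hasColimitsOfShape (J := ℕᵒᵖ) (C := Ind Cᵒᵖ)
  exact inferInstanceAs (HasLimitsOfShape ℕᵒᵖ (Ind Cᵒᵖ)ᵒᵖ)

lemma ind_map_comp_hom {X Y : Ind Cᵒᵖ} {f g : X ⟶ Y}
    (h : ∀ Z x, ((Ind.inclusion Cᵒᵖ).map f).app Z x = ((Ind.inclusion Cᵒᵖ).map g).app Z x) :
    f = g := by
  apply (Ind.inclusion Cᵒᵖ).map_injective
  ext Z x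
  exact h Z x

section Additive

variable (C) [Abelian C]

instance : HasFiniteBiproducts Cᵒᵖᵒᵖ := HasFiniteBiproducts.of_hasFiniteProducts

/-- Ind-objects as left exact presheaves of sets. -/
def indToLex : Ind Cᵒᵖ ⥤ (Cᵒᵖᵒᵖ ⥤ₗ Type v) :=
  ObjectProperty.lift _ (Ind.inclusion Cᵒᵖ)
    (fun X => preservesFiniteLimits_of_isIndObject _ _ X.isIndObject_inclusion_obj)

/-- `indToLex` is fully faithful. -/
def indToLexFullyFaithful : (indToLex C).FullyFaithful where
  preimage f := (Ind.inclusion Cᵒᵖ).preimage f.hom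
  map_preimage f := ObjectProperty.hom_ext _ ((Ind.inclusion Cᵒᵖ).map_preimage f.hom)
  preimage_map f := (Ind.inclusion Cᵒᵖ).preimage_map f

instance : (indToLex C).Full := (indToLexFullyFaithful C).full
instance : (indToLex C).Faithful := (indToLexFullyFaithful C).faithful

/-- Ind-objects as left exact presheaves of abelian groups. -/
def indToGrp : Ind Cᵒᵖ ⥤ (Cᵒᵖᵒᵖ ⥤ₗ AddCommGrpCat.{v}) :=
  indToLex C ⋙ (AddCommGrpCat.leftExactFunctorForgetEquivalence Cᵒᵖᵒᵖ).inverse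

instance : (indToGrp C).Full := by unfold indToGrp; infer_instance
instance : (indToGrp C).Faithful := by unfold indToGrp; infer_instance

/-- The embedding of `Ind Cᵒᵖ` into functors to abelian groups is fully faithful. -/
def indToGrpFullyFaithful : (indToGrp C ⋙ ObjectProperty.ι _).FullyFaithful :=
  (Functor.FullyFaithful.ofFullyFaithful (indToGrp C)).comp (ObjectProperty.fullyFaithfulι _)

/-- The preadditive structure on ind-objects, for which the embedding into left exact presheaves of
abelian groups is additive. -/
abbrev indPreadditive : Preadditive (Ind Cᵒᵖ) := .ofFullyFaithful (indToGrpFullyFaithful C)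

attribute [local instance] indPreadditive

lemma indToGrp_add {X Y : Ind Cᵒᵖ} (f g : X ⟶ Y) (Z : Cᵒᵖᵒᵖ)
    (x : ((Ind.inclusion Cᵒᵖ).obj X).obj Z) :
    (((indToGrp C).map (f + g)).hom.app Z : _ → _) x =
      ((((indToGrp C).map f).hom.app Z : _ → _) x) + ((((indToGrp C).map g).hom.app Z : _ → _) x) := by
  have := (indToGrpFullyFaithful C).additive_ofFullyFaithful.map_add (f := f) (g := g)
  exact ConcreteCategory.congr_hom (congr_app this Z) x

lemma indToGrp_map {X Y : Ind Cᵒᵖ} (f : X ⟶ Y) (Z : Cᵒᵖᵒᵖ)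
    (x : ((Ind.inclusion Cᵒᵖ).obj X).obj Z) :
    (((indToGrp C).map f).hom.app Z : _ → _) x =
      ((Ind.inclusion Cᵒᵖ).map f).app Z x := rfl

lemma indToGrp_obj_map (X : Ind Cᵒᵖ) {Z W : Cᵒᵖᵒᵖ} (g : Z ⟶ W)
    (x : ((Ind.inclusion Cᵒᵖ).obj X).obj Z) :
    (((indToGrp C).obj X).obj.map g : _ → _) x =
      ((Ind.inclusion Cᵒᵖ).obj X).map g x := rfl

instance (X : Ind Cᵒᵖ) : ((indToGrp C).obj X).obj.Additive := by
  have : PreservesFiniteLimits ((indToGrp C).obj X).obj := ((indToGrp C).obj X).property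
  exact Functor.additive_of_preserves_binary_products _

variable {R : Type w} [CommRing R] [Linear R C]

/-- The natural endomorphism of the ind-object `X` given by the action of `r`. -/
def indAct (r : R) (X : Ind Cᵒᵖ) : X ⟶ X :=
  (Ind.inclusion Cᵒᵖ).preimage
    { app := fun Z => ((Ind.inclusion Cᵒᵖ).obj X).map (r • 𝟙 Z.unop.unop).op.op
      naturality := fun Z W f => by
        rw [← Functor.map_comp, ← Functor.map_comp]
        congr 1
        apply Quiver.Hom.unop_inj
        apply Quiver.Hom.unop_inj
        simp }

lemma indAct_app (r : R) (X : Ind Cᵒᵖ) (Z : Cᵒᵖᵒᵖ) (x) :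
    ((Ind.inclusion Cᵒᵖ).map (indAct C r X)).app Z x =
      ((Ind.inclusion Cᵒᵖ).obj X).map (r • 𝟙 Z.unop.unop).op.op x := by
  simp [indAct]

lemma indAct_naturality (r : R) {X Y : Ind Cᵒᵖ} (f : X ⟶ Y) :
    indAct C r X ≫ f = f ≫ indAct C r Y := by
  apply ind_map_comp_hom
  intro Z x
  simp only [Functor.map_comp, NatTrans.comp_app, CategoryTheory.comp_apply, indAct_app]
  exact NatTrans.naturality_apply _ _ _

lemma indAct_one (X : Ind Cᵒᵖ) : indAct C (1 : R) X = 𝟙 X := by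
  apply ind_map_comp_hom
  intro Z x
  simp [indAct_app]

lemma indAct_mul (r s : R) (X : Ind Cᵒᵖ) : indAct C (r * s) X = indAct C r X ≫ indAct C s X := by
  apply ind_map_comp_hom
  intro Z x
  simp only [Functor.map_comp, NatTrans.comp_app, CategoryTheory.comp_apply, indAct_app]
  rw [← CategoryTheory.comp_apply, ← Functor.map_comp, ← op_comp, ← op_comp]
  rw [mul_comm r s]; simp [mul_smul]

lemma indAct_add (r s : R) (X : Ind Cᵒᵖ) : indAct C (r + s) X = indAct C r X + indAct C s X := by
  apply ind_map_comp_hom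
  intro Z x
  refine Eq.trans ?_ (indToGrp_add C (indAct C r X) (indAct C s X) Z x).symm
  refine (indAct_app C (r + s) X Z x).trans ?_
  have h2 := ((indToGrp C).obj X).obj.map_add (f := (r • 𝟙 Z.unop.unop).op.op)
    (g := (s • 𝟙 Z.unop.unop).op.op)
  have h3 := ConcreteCategory.congr_hom h2 x
  rw [add_smul]
  refine Eq.trans h3 ?_
  exact congrArg₂ (fun a b : ((indToGrp C).obj X).obj.obj Z => a + b)
    (indAct_app C r X Z x).symm (indAct_app C s X Z x).symm

end Additive

/-- The action of `r` on a pro-object: on `(M_α)_α` it is given by the action of `r` on each `M_α`. -/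
def Pro.act [Abelian C] {R : Type w} [CommRing R] [Linear R C] (r : R) (X : Pro C) : X ⟶ X :=
  (indAct C r X.unop).op

instance [Abelian C] : Preadditive (Pro C) :=
  letI := indPreadditive C
  inferInstanceAs (Preadditive (Ind Cᵒᵖ)ᵒᵖ)

section

variable [Abelian C] {R : Type w} [CommRing R] [Linear R C]

lemma Pro.act_comp (r : R) {X Y : Pro C} (f : X ⟶ Y) : Pro.act r X ≫ f = f ≫ Pro.act r Y :=
  Quiver.Hom.unop_inj (indAct_naturality C r f.unop).symm

lemma Pro.act_one (X : Pro C) : Pro.act (1 : R) X = 𝟙 X :=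
  Quiver.Hom.unop_inj (indAct_one C X.unop)

lemma Pro.act_mul (r s : R) (X : Pro C) : Pro.act (r * s) X = Pro.act r X ≫ Pro.act s X := by
  rw [mul_comm]
  exact Quiver.Hom.unop_inj (indAct_mul C s r X.unop)

lemma Pro.act_add (r s : R) (X : Pro C) : Pro.act (r + s) X = Pro.act r X + Pro.act s X :=
  Quiver.Hom.unop_inj (indAct_add C r s X.unop)

lemma Pro.act_zero (X : Pro C) : Pro.act (0 : R) X = 0 := by
  have h := Pro.act_add (0 : R) 0 X
  rw [add_zero] at h
  exact left_eq_add.mp h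

/-- The `R`-linear structure on `Pro C` that is induced by the one on `C`. -/
instance : Linear R (Pro C) where
  homModule X Y :=
    { smul := fun r f => Pro.act r X ≫ f
      one_smul := fun f => by
        change Pro.act (1 : R) X ≫ f = f
        rw [Pro.act_one, Category.id_comp]
      mul_smul := fun r s f => by
        change Pro.act (r * s) X ≫ f = Pro.act r X ≫ Pro.act s X ≫ f
        rw [Pro.act_mul, Category.assoc]
      smul_zero := fun r => by
        change Pro.act r X ≫ 0 = 0
        exact comp_zero
      smul_add := fun r f g => by
        change Pro.act r X ≫ (f + g) = Pro.act r X ≫ f + Pro.act r X ≫ g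
        exact Preadditive.comp_add _ _ _ _ _ _
      add_smul := fun r s f => by
        change Pro.act (r + s) X ≫ f = Pro.act r X ≫ f + Pro.act s X ≫ f
        rw [Pro.act_add, Preadditive.add_comp]
      zero_smul := fun f => by
        change Pro.act (0 : R) X ≫ f = 0
        rw [Pro.act_zero, zero_comp] }
  smul_comp X Y Z r f g := Category.assoc _ _ _
  comp_smul X Y Z f r g := by
    change f ≫ Pro.act r Y ≫ g = Pro.act r X ≫ f ≫ g
    rw [← Category.assoc, ← Pro.act_comp, Category.assoc]

lemma Pro.smul_def (r : R) {X Y : Pro C} (f : X ⟶ Y) : r • f = Pro.act r X ≫ f := rfl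

lemma indAct_yoneda (r : R) (X : C) :
    indAct C r (Ind.yoneda.obj (op X)) = Ind.yoneda.map (r • 𝟙 X).op := by
  apply ind_map_comp_hom
  intro Z x
  rw [indAct_app]
  let e := (Ind.yonedaCompInclusion (C := Cᵒᵖ)).hom
  have he : Function.Injective ((e.app (op X)).app Z) := by
    rw [← mono_iff_injective]
    infer_instance
  apply he
  have h1 := NatTrans.naturality_apply (e.app (op X)) (r • 𝟙 Z.unop.unop).op.op x
  have h2 := ConcreteCategory.congr_hom (congr_app (e.naturality (r • 𝟙 X).op) Z) x
  refine h1.trans (Eq.trans ?_ h2.symm)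
  change (r • 𝟙 Z.unop.unop).op ≫ (e.app (op X)).app Z x =
    (e.app (op X)).app Z x ≫ (r • 𝟙 X).op
  apply Quiver.Hom.unop_inj
  generalize (e.app (op X)).app Z x = y
  change y.unop ≫ (r • 𝟙 _) = (r • 𝟙 _) ≫ y.unop
  simp

lemma Pro.of_map_smul (r : R) {X Y : C} (f : X ⟶ Y) :
    Pro.of.map (r • f) = r • Pro.of.map f := by
  have h : Pro.act r (Pro.of.obj X) = Pro.of.map (r • 𝟙 X) :=
    Quiver.Hom.unop_inj (indAct_yoneda r X)
  rw [Pro.smul_def, h, ← Functor.map_comp, Linear.smul_comp, Category.id_comp]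

end

section Quotient

variable {D : Type u} [Category.{v} D] [Preadditive D] [HasFiniteCoproducts D] [HasCokernels D]
  {R : Type w} [CommRing R] [IsNoetherianRing R] [Linear R D]

/-- A finite set of generators of an ideal. -/
def gens (I : Ideal R) : Finset R := (IsNoetherian.noetherian I).choose

lemma span_gens (I : Ideal R) : Ideal.span (gens I : Set R) = I :=
  (IsNoetherian.noetherian I).choose_spec

/-- The map `(f₁, …, f_p) : M ⊕ ⋯ ⊕ M ⟶ M` given by generators `f₁, …, f_p` of `I`; its image
is `MI`. -/
def genMap (I : Ideal R) (M : D) : (∐ fun _ : gens I => M) ⟶ M :=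
  Sigma.desc fun r => (r : R) • 𝟙 M

/-- The quotient `M/MI = M ⊗ R/I` of an object of an `R`-linear category. -/
def quot (I : Ideal R) (M : D) : D := cokernel (genMap I M)

/-- The projection `M ⟶ M/MI`. -/
def quotπ (I : Ideal R) (M : D) : M ⟶ quot I M := cokernel.π (genMap I M)

instance (I : Ideal R) (M : D) : Epi (quotπ I M) :=
  inferInstanceAs (Epi (cokernel.π (genMap I M)))

lemma smul_quotπ {I : Ideal R} (M : D) {r : R} (hr : r ∈ I) : r • quotπ I M = 0 := by
  rw [← span_gens I] at hr
  induction hr using Submodule.span_induction with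
  | mem x hx =>
    have h := Sigma.ι (fun _ : gens I => M) ⟨x, hx⟩ ≫= cokernel.condition (genMap I M)
    rw [genMap, Sigma.ι_desc_assoc, comp_zero, Linear.smul_comp, Category.id_comp] at h
    exact h
  | zero => rw [zero_smul]
  | add x y _ _ hx hy => rw [add_smul, hx, hy, add_zero]
  | smul a x _ hx => rw [smul_eq_mul, mul_smul, hx, smul_zero]

/-- The map `M/MI ⟶ Y` induced by a map `M ⟶ Y` that is killed by `I`. -/
def quotDesc (I : Ideal R) {M Y : D} (g : M ⟶ Y) (hg : ∀ r ∈ I, r • g = 0) : quot I M ⟶ Y :=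
  cokernel.desc (genMap I M) g (by
    apply Sigma.hom_ext
    rintro ⟨r, hr⟩
    rw [genMap, Sigma.ι_desc_assoc, comp_zero, Linear.smul_comp, Category.id_comp]
    exact hg r ((span_gens I).le (Ideal.subset_span hr)))

@[simp]
lemma quotπ_quotDesc (I : Ideal R) {M Y : D} (g : M ⟶ Y) (hg : ∀ r ∈ I, r • g = 0) :
    quotπ I M ≫ quotDesc I g hg = g :=
  cokernel.π_desc _ _ _

@[simp]
lemma quotπ_quotDesc_assoc (I : Ideal R) {M Y Z : D} (g : M ⟶ Y) (hg : ∀ r ∈ I, r • g = 0)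
    (k : Y ⟶ Z) : quotπ I M ≫ quotDesc I g hg ≫ k = g ≫ k := by
  rw [← Category.assoc, quotπ_quotDesc]

/-- The map `M/MI ⟶ M'/M'I'` induced by `f : M ⟶ M'` when `I ≤ I'`. -/
def quotMap {I I' : Ideal R} (h : I ≤ I') {M M' : D} (f : M ⟶ M') : quot I M ⟶ quot I' M' :=
  quotDesc I (f ≫ quotπ I' M') fun r hr => by
    rw [← Linear.comp_smul, smul_quotπ M' (h hr), comp_zero]

@[simp]
lemma quotπ_quotMap {I I' : Ideal R} (h : I ≤ I') {M M' : D} (f : M ⟶ M') :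
    quotπ I M ≫ quotMap h f = f ≫ quotπ I' M' :=
  quotπ_quotDesc _ _ _

@[simp]
lemma quotπ_quotMap_assoc {I I' : Ideal R} (h : I ≤ I') {M M' Z : D} (f : M ⟶ M')
    (k : quot I' M' ⟶ Z) : quotπ I M ≫ quotMap h f ≫ k = f ≫ quotπ I' M' ≫ k := by
  rw [← Category.assoc, quotπ_quotMap, Category.assoc]

/-- The inverse system `(M/MJⁿ)ₙ`, as a functor of `M`. -/
def tower (J : Ideal R) : D ⥤ (ℕᵒᵖ ⥤ D) where
  obj M :=
    { obj := fun n => quot (J ^ n.unop) M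
      map := fun i => quotMap (Ideal.pow_le_pow_right (leOfHom i.unop)) (𝟙 M)
      map_id := fun n => by simp [← cancel_epi (quotπ (J ^ n.unop) M)]
      map_comp := fun {n _ _} _ _ => by simp [← cancel_epi (quotπ (J ^ n.unop) M)] }
  map f :=
    { app := fun n => quotMap le_rfl f
      naturality := fun n _ _ => by simp [← cancel_epi (quotπ (J ^ n.unop) _)] }
  map_id M := by
    ext n
    simp [← cancel_epi (quotπ (J ^ n.unop) M)]
  map_comp {M _ _} f g := by
    ext n
    simp [← cancel_epi (quotπ (J ^ n.unop) M)]

/-- The cone over `(M/MJⁿ)ₙ` formed by the projections `M ⟶ M/MJⁿ`. -/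
def towerCone (J : Ideal R) (M : D) : Cone ((tower J).obj M) where
  pt := M
  π :=
    { app := fun n => quotπ (J ^ n.unop) M
      naturality := fun n m i => by simp [tower] }

end Quotient

section Completion

variable {R : Type w} [CommRing R] [IsNoetherianRing R] (J : Ideal R)
  (C : Type u) [Category.{v} C] [Abelian C] [Linear R C]

variable {C} in
/-- The pro-objects `M` such that `M/MJⁿ` lies in (the essential image of) `C` for all `n` and such
that the canonical map `M ⟶ lim M/MJⁿ` is an isomorphism. -/
structure IsAdicallyComplete (M : Pro C) : Prop where
  quot_mem (n : ℕ) : (Pro.of (C := C)).essImage (quot (J ^ n) M)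
  isIso : IsIso (limit.lift ((tower J).obj M) (towerCone J M))

/-- The completion `Ĉ` of `C`, a full subcategory of `Pro C`. -/
abbrev Completion : Type (max u (v + 1)) :=
  ObjectProperty.FullSubcategory (C := Pro C) (fun M => IsAdicallyComplete J M)

variable {C} in
/-- The inverse systems `⋯ ⟶ N₂ ⟶ N₁ ⟶ N₀` with `NₙJⁿ = 0` such that the transition maps
induce isomorphisms `Nₙ₊₁/Nₙ₊₁Jⁿ ⟶ Nₙ`. -/
structure IsAdicSystem (N : ℕᵒᵖ ⥤ C) : Prop where
  smul_eq_zero (n : ℕ) (r : R) (hr : r ∈ J ^ n) : r • 𝟙 (N.obj (op n)) = 0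
  isIso (n : ℕ) : IsIso (quotDesc (J ^ n) (N.map (homOfLE n.le_succ).op) fun r hr => by
    rw [← Category.comp_id (N.map _), ← Linear.comp_smul, smul_eq_zero n r hr, comp_zero])

/-- The category `Č` of `J`-adic inverse systems over `C`. -/
abbrev AdicSystem : Type (max u v) :=
  ObjectProperty.FullSubcategory (C := ℕᵒᵖ ⥤ C) (fun N => IsAdicSystem J N)

variable {C} in
lemma isAdicSystem_of_iso {N : ℕᵒᵖ ⥤ C} {M : Pro C}
    (a : ∀ n : ℕ, Pro.of.obj (N.obj (op n)) ≅ quot (J ^ n) M)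
    (ha : ∀ n : ℕ, Pro.of.map (N.map (homOfLE n.le_succ).op) ≫ (a n).hom =
      (a (n + 1)).hom ≫ quotMap (Ideal.pow_le_pow_right n.le_succ) (𝟙 M)) :
    IsAdicSystem J N := by
  have zero : ∀ {X Y : C}, Pro.of.map (0 : X ⟶ Y) = 0 := fun {X Y} => by
    rw [← zero_smul R (0 : X ⟶ Y), Pro.of_map_smul, zero_smul]
  have h0 : ∀ (n : ℕ) (r : R), r ∈ J ^ n → r • 𝟙 (N.obj (op n)) = 0 := by
    intro n r hr
    apply Pro.of.map_injective
    rw [Pro.of_map_smul, zero, CategoryTheory.Functor.map_id, ← cancel_mono (a n).hom, zero_comp,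
      Linear.smul_comp, Category.id_comp, ← cancel_epi (a n).inv, comp_zero,
      Linear.comp_smul, Iso.inv_hom_id, ← cancel_epi (quotπ (J ^ n) M), comp_zero,
      Linear.comp_smul, Category.comp_id, smul_quotπ M hr]
  refine ⟨h0, fun n => ?_⟩
  set φ := N.map (homOfLE n.le_succ).op with hφ
  have hk : ∀ r ∈ J ^ n, r • φ = 0 := fun r hr => by
    rw [← Category.comp_id φ, ← Linear.comp_smul, h0 n r hr, comp_zero]
  change IsIso (quotDesc (J ^ n) φ hk)
  let p : quot (J ^ (n + 1)) M ⟶ quot (J ^ n) M :=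
    quotMap (Ideal.pow_le_pow_right n.le_succ) (𝟙 M)
  have hp : Pro.of.map φ ≫ (a n).hom = (a (n + 1)).hom ≫ p := ha n
  have hπp : quotπ (J ^ (n + 1)) M ≫ p = quotπ (J ^ n) M := by simp [p]
  have : Epi p := epi_of_epi_fac hπp
  have : Epi φ := by
    apply Pro.of.epi_of_epi_map
    rw [(Iso.eq_comp_inv (a n)).mpr hp]
    infer_instance
  let q := quotπ (J ^ n) (N.obj (op (n + 1)))
  let k := (a (n + 1)).inv ≫ Pro.of.map q
  let d : quot (J ^ n) M ⟶ Pro.of.obj (quot (J ^ n) (N.obj (op (n + 1)))) :=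
    quotDesc (J ^ n) (quotπ (J ^ (n + 1)) M ≫ k) fun r hr => by
      rw [← Linear.comp_smul, ← Linear.comp_smul, ← Pro.of_map_smul, smul_quotπ _ hr, zero,
        comp_zero, comp_zero]
  have hd : p ≫ d = k := by
    rw [← cancel_epi (quotπ (J ^ (n + 1)) M), ← Category.assoc, hπp]
    exact quotπ_quotDesc _ _ _
  obtain ⟨h, hh⟩ := Pro.of.map_surjective ((a n).hom ≫ d)
  have hφh : φ ≫ h = q := by
    apply Pro.of.map_injective
    rw [Functor.map_comp, hh, ← Category.assoc, hp, Category.assoc, hd, Iso.hom_inv_id_assoc]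
  refine ⟨h, ?_, ?_⟩
  · rw [← cancel_epi (quotπ (J ^ n) (N.obj (op (n + 1)))), quotπ_quotDesc_assoc, hφh,
      Category.comp_id]
  · rw [← cancel_epi φ, ← Category.assoc, hφh, quotπ_quotDesc, Category.comp_id]

/-- The functor `M ↦ (M/MJⁿ)ₙ` on `Ĉ`, with values in inverse systems of pro-objects that lie in
(the essential image of) `C`. -/
def towerInC : Completion J C ⥤ (ℕᵒᵖ ⥤ (Pro.of (C := C)).EssImageSubcategory) where
  obj M := ObjectProperty.lift _ ((tower J).obj M.obj) fun n => M.property.quot_mem n.unop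
  map f :=
    { app := fun n => ObjectProperty.homMk (((tower J).map f.hom).app n)
      naturality := fun n m i => by
        apply ObjectProperty.hom_ext
        exact ((tower J).map f.hom).naturality i }
  map_id M := by
    ext n
    exact congr_app ((tower J).map_id M.obj) n
  map_comp f g := by
    ext n
    exact congr_app ((tower J).map_comp f.hom g.hom) n

instance : (Pro.of (C := C)).toEssImage.IsEquivalence where

/-- The functor `M ↦ (M/MJⁿ)ₙ` from `Ĉ` to inverse systems over `C`. -/
def towerC : Completion J C ⥤ (ℕᵒᵖ ⥤ C) :=
  towerInC J C ⋙ (Functor.whiskeringRight _ _ _).obj (Pro.of (C := C)).toEssImage.inv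

/-- Regarded as an inverse system in `Pro C`, `towerC` is `M ↦ (M/MJⁿ)ₙ`. -/
def towerCIso : towerC J C ⋙ (Functor.whiskeringRight _ _ _).obj Pro.of ≅
    ObjectProperty.ι _ ⋙ tower J :=
  NatIso.ofComponents
    (fun M => NatIso.ofComponents
      (fun n => (ObjectProperty.ι _).mapIso
        ((Pro.of (C := C)).toEssImage.asEquivalence.counitIso.app (((towerInC J C).obj M).obj n)))
      (fun i => congrArg (fun f => f.hom)
        ((Pro.of (C := C)).toEssImage.asEquivalence.counitIso.hom.naturality
          (((towerInC J C).obj M).map i))))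
    (fun f => by
      ext n
      exact congrArg (fun f => f.hom)
        ((Pro.of (C := C)).toEssImage.asEquivalence.counitIso.hom.naturality
          (((towerInC J C).map f).app n)))

/-- The functor `Σ : Ĉ ⥤ Č`, `M ↦ (M/MJⁿ)ₙ`. -/
def sigma : Completion J C ⥤ AdicSystem J C :=
  ObjectProperty.lift _ (towerC J C) fun M =>
    isAdicSystem_of_iso J (fun n => ((towerCIso J C).app M).app (op n))
      (fun n => ((towerCIso J C).app M).hom.naturality (homOfLE n.le_succ).op)

/-- The functor `(Nₙ)ₙ ↦ lim Nₙ` from `Č` to `Pro C`, the limit being taken in `Pro C`. -/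
def limPro : AdicSystem J C ⥤ Pro C :=
  ObjectProperty.ι _ ⋙ (Functor.whiskeringRight _ _ _).obj Pro.of ⋙ lim

/-- The functor `Ψ : Č ⥤ Ĉ`, `(Nₙ)ₙ ↦ lim Nₙ`, provided that all these limits lie in `Ĉ`. -/
def psi (h : ∀ N : AdicSystem J C, IsAdicallyComplete J ((limPro J C).obj N)) :
    AdicSystem J C ⥤ Completion J C :=
  ObjectProperty.lift _ (limPro J C) h

end Completion

end JAdic

end

/-!
Let `L` be the limit of a `J`-adic system `(Nₙ)ₙ`, taken in `Pro C`. Everything follows from the fact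
that the projection `L ⟶ N_m` induces an isomorphism `L/LJᵐ ≅ N_m` (`isIso_quotConeDesc`).

Its proof uses two properties of the objects `Z` of `C` inside `Pro C`, which both come from the
presheaf description of ind-objects over `Cᵒᵖ`: they detect isomorphisms
(`Pro.isIso_of_bijective`), and they are cocompact, that is, `Hom (lim Kₙ) Z = colim Hom Kₙ Z`
(`Pro.exists_eq_π_comp`, `Pro.exists_map_comp_eq`). Hence it suffices to see that every map `L ⟶ Z`
that is killed by `Jᵐ` factors uniquely through `N_m`. Such a map comes from a map `N_k ⟶ Z` with
`m ≤ k`; as `Jᵐ` is finitely generated, the latter is killed by `Jᵐ` after increasing `k`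
(`exists_smul_map_comp_eq_zero`), so it factors through `N_k/N_kJᵐ = N_m`
(`IsAdicSystem.exists_eq_map_comp`). Uniqueness holds because the transition maps are epimorphisms.

The isomorphisms `L/LJᵐ ≅ N_m` are natural. On limits they induce an inverse of the canonical map
`L ⟶ lim L/LJᵐ`, so `L` lies in the completion, and they identify `psi ⋙ sigma` with the identity.
The identity is identified with `sigma ⋙ psi` by the canonical map `M ⟶ lim M/MJⁿ`, an isomorphism by
definition of the completion.
-/

noncomputable section

namespace JAdic

/-! ### Cocompactness of the objects of `C` in `Pro C` -/

section Cocompact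

variable {C : Type u} [Category.{v} C]

/-- Maps from a pro-object `X` to an object `Z` of `C` are the elements at `Z` of the presheaf that
underlies `X`, by the Yoneda lemma. -/
def Pro.homOfEquiv (X : Pro C) (Z : C) :
    (X ⟶ Pro.of.obj Z) ≃ ((Ind.inclusion Cᵒᵖ).obj X.unop).obj (op (op Z)) :=
  (opEquiv X (Pro.of.obj Z)).trans <|
    (Ind.inclusion.fullyFaithful (C := Cᵒᵖ)).homEquiv.trans <|
      ((Ind.yonedaCompInclusion (C := Cᵒᵖ)).app (op Z)).homFromEquiv.trans yonedaEquiv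

lemma Pro.homOfEquiv_comp {X Y : Pro C} {Z : C} (f : X ⟶ Y) (g : Y ⟶ Pro.of.obj Z) :
    Pro.homOfEquiv X Z (f ≫ g) =
      ((Ind.inclusion Cᵒᵖ).map f.unop).app (op (op Z)) (Pro.homOfEquiv Y Z g) := by
  have h : (Ind.inclusion Cᵒᵖ).map (f ≫ g).unop =
      (Ind.inclusion Cᵒᵖ).map g.unop ≫ (Ind.inclusion Cᵒᵖ).map f.unop := by
    rw [← Functor.map_comp]
    rfl
  change yonedaEquiv (_ ≫ (Ind.inclusion Cᵒᵖ).map (f ≫ g).unop) = _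
  rw [h]
  exact (congrArg yonedaEquiv (Category.assoc _ _ _).symm).trans (yonedaEquiv_comp _ _)

/-- The objects of `C` detect isomorphisms of pro-objects. -/
lemma Pro.isIso_of_bijective {X Y : Pro C} (f : X ⟶ Y)
    (h : ∀ Z : C, Function.Bijective fun g : Y ⟶ Pro.of.obj Z => f ≫ g) : IsIso f := by
  have h1 : ∀ Z, IsIso (((Ind.inclusion Cᵒᵖ).map f.unop).app Z) := by
    intro Z
    rw [isIso_iff_bijective]
    have h2 : (((Ind.inclusion Cᵒᵖ).map f.unop).app Z : _ → _) =
        Pro.homOfEquiv X Z.unop.unop ∘ (fun g => f ≫ g) ∘ (Pro.homOfEquiv Y Z.unop.unop).symm := by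
      ext x
      simp only [Function.comp_apply, Pro.homOfEquiv_comp, Equiv.apply_symm_apply]
    rw [h2]
    exact (Equiv.bijective _).comp ((h _).comp (Equiv.bijective _))
  have h3 : IsIso ((Ind.inclusion Cᵒᵖ).map f.unop) := NatIso.isIso_of_isIso_app _
  have h4 : IsIso f.unop := isIso_of_fully_faithful (Ind.inclusion Cᵒᵖ) _
  exact (inferInstance : IsIso f.unop.op)

-- Filtered colimits in `Ind` are indexed by small categories in `Type v`, whence `AsSmall ℕ`.
instance : PreservesColimitsOfShape ℕ (Ind.inclusion Cᵒᵖ) :=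
  preservesColimitsOfShape_of_equiv (AsSmall.equiv (C := ℕ)).symm _

/-- The elements at `Z` of the limit of an inverse system of pro-objects form the colimit of the
elements at `Z` of its terms. -/
def Pro.isColimitOfIsLimit {K : ℕᵒᵖ ⥤ Pro C} {c : Cone K} (hc : IsLimit c) (Z : C) :
    IsColimit ((Ind.inclusion Cᵒᵖ ⋙ (evaluation _ _).obj (op (op Z))).mapCocone
      (coconeUnopOfCone (C := Ind Cᵒᵖ) c)) :=
  isColimitOfPreserves _ (isColimitCoconeUnopOfCone (C := Ind Cᵒᵖ) K hc)

/-- An object `Z` of `C` is cocompact in `Pro C`, surjectivity part: every map `lim Kₙ ⟶ Z` factors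
through some `K_n`. -/
lemma Pro.exists_eq_π_comp {K : ℕᵒᵖ ⥤ Pro C} {c : Cone K} (hc : IsLimit c) {Z : C}
    (f : c.pt ⟶ Pro.of.obj Z) : ∃ n g, f = c.π.app n ≫ g := by
  obtain ⟨n, y, hy⟩ := Types.jointly_surjective_of_isColimit (Pro.isColimitOfIsLimit hc Z)
    (Pro.homOfEquiv _ Z f)
  refine ⟨op n, (Pro.homOfEquiv _ Z).symm y, ?_⟩
  apply (Pro.homOfEquiv _ Z).injective
  rw [Pro.homOfEquiv_comp, Equiv.apply_symm_apply]
  exact hy.symm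

/-- An object `Z` of `C` is cocompact in `Pro C`, injectivity part: two maps `K_n ⟶ Z` that agree on
`lim Kₙ` already agree on some `K_m`. -/
lemma Pro.exists_map_comp_eq {K : ℕᵒᵖ ⥤ Pro C} {c : Cone K} (hc : IsLimit c) {Z : C} {n : ℕᵒᵖ}
    {f g : K.obj n ⟶ Pro.of.obj Z} (h : c.π.app n ≫ f = c.π.app n ≫ g) :
    ∃ (m : ℕᵒᵖ) (i : m ⟶ n), K.map i ≫ f = K.map i ≫ g := by
  replace h := congrArg (Pro.homOfEquiv _ Z) h
  rw [Pro.homOfEquiv_comp, Pro.homOfEquiv_comp] at h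
  obtain ⟨m, i, hi⟩ := (Types.FilteredColimit.isColimit_eq_iff' (Pro.isColimitOfIsLimit hc Z)
    _ _).1 h
  refine ⟨op m, i.op, (Pro.homOfEquiv _ Z).injective ?_⟩
  rw [Pro.homOfEquiv_comp, Pro.homOfEquiv_comp]
  exact hi

end Cocompact

/-! ### Reduction of the limit of an adic system -/

section Reduction

variable {C : Type u} [Category.{v} C] [Abelian C] {R : Type w} [CommRing R] [Linear R C]

lemma Pro.of_map_zero (R : Type w) [CommRing R] [Linear R C] {X Y : C} :
    Pro.of.map (0 : X ⟶ Y) = 0 := by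
  rw [← zero_smul R (0 : X ⟶ Y), Pro.of_map_smul, zero_smul]

variable [IsNoetherianRing R] {J : Ideal R} {N : ℕᵒᵖ ⥤ C}

lemma IsAdicSystem.smul_map_succ (hN : IsAdicSystem J N) (n : ℕ) (r : R) (hr : r ∈ J ^ n) :
    r • N.map (homOfLE n.le_succ).op = 0 := by
  rw [← Category.comp_id (N.map _), ← Linear.comp_smul, hN.smul_eq_zero n r hr, comp_zero]

/-- A map out of `Nₙ₊₁` that is killed by `Jⁿ` factors through the transition map `Nₙ₊₁ ⟶ Nₙ`. -/
lemma IsAdicSystem.exists_succ (hN : IsAdicSystem J N) {n : ℕ} {Z : C}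
    (g : N.obj (op (n + 1)) ⟶ Z) (hg : ∀ r ∈ J ^ n, r • g = 0) :
    ∃ h, g = N.map (homOfLE n.le_succ).op ≫ h := by
  have := hN.isIso n
  refine ⟨inv (quotDesc (J ^ n) (N.map (homOfLE n.le_succ).op) (hN.smul_map_succ n)) ≫
    quotDesc (J ^ n) g hg, ?_⟩
  rw [← quotπ_quotDesc_assoc (J ^ n) (N.map (homOfLE n.le_succ).op)
    (hN.smul_map_succ n), IsIso.hom_inv_id_assoc, quotπ_quotDesc]

lemma IsAdicSystem.epi_succ (hN : IsAdicSystem J N) (n : ℕ) :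
    Epi (N.map (homOfLE n.le_succ).op) := by
  have := hN.isIso n
  rw [← quotπ_quotDesc (J ^ n) (N.map (homOfLE n.le_succ).op) (hN.smul_map_succ n)]
  exact epi_comp _ _

lemma IsAdicSystem.epi_map (hN : IsAdicSystem J N) {m n : ℕ} (h : m ≤ n) :
    Epi (N.map (homOfLE h).op) := by
  induction n, h using Nat.le_induction with
  | base => exact (inferInstance : Epi (N.map (𝟙 (op m))))
  | succ n h ih =>
    have := hN.epi_succ n
    rw [← homOfLE_comp h n.le_succ, op_comp, N.map_comp]
    exact epi_comp _ _

/-- For `m ≤ n`, a map out of `N_n` that is killed by `Jᵐ` factors through `N_n ⟶ N_m`; as this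
transition map is an epimorphism, it exhibits `N_m` as `N_n/N_nJᵐ`. -/
lemma IsAdicSystem.exists_eq_map_comp (hN : IsAdicSystem J N) {m n : ℕ} (h : m ≤ n) {Z : C}
    (g : N.obj (op n) ⟶ Z) (hg : ∀ r ∈ J ^ m, r • g = 0) :
    ∃ k, g = N.map (homOfLE h).op ≫ k := by
  induction n, h using Nat.le_induction with
  | base => exact ⟨g, by simp⟩
  | succ n h ih =>
    obtain ⟨k, rfl⟩ := hN.exists_succ g fun r hr => hg r (Ideal.pow_le_pow_right h hr)
    have := hN.epi_succ n
    obtain ⟨l, rfl⟩ := ih k fun r hr => by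
      rw [← cancel_epi (N.map (homOfLE n.le_succ).op), Linear.comp_smul, hg r hr, comp_zero]
    refine ⟨l, ?_⟩
    rw [← homOfLE_comp h n.le_succ, op_comp, N.map_comp, Category.assoc]

lemma IsAdicSystem.smul_of_eq_zero (hN : IsAdicSystem J N) (m : ℕ) {X : Pro C}
    (f : X ⟶ Pro.of.obj (N.obj (op m))) {r : R} (hr : r ∈ J ^ m) : r • f = 0 := by
  rw [← Category.comp_id f, ← Linear.comp_smul, ← CategoryTheory.Functor.map_id,
    ← Pro.of_map_smul, hN.smul_eq_zero m r hr, Pro.of_map_zero R, comp_zero]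

/-- The map `L/LJᵐ ⟶ N_m` that is induced by the projection `L ⟶ N_m`, for a cone over `(Nₙ)ₙ` in
`Pro C` with apex `L`. -/
def quotConeDesc (hN : IsAdicSystem J N) (c : Cone (N ⋙ Pro.of)) (m : ℕ) :
    quot (J ^ m) c.pt ⟶ Pro.of.obj (N.obj (op m)) :=
  quotDesc (J ^ m) (c.π.app (op m)) fun _ hr => hN.smul_of_eq_zero m _ hr

@[simp]
lemma quotπ_quotConeDesc (hN : IsAdicSystem J N) (c : Cone (N ⋙ Pro.of)) (m : ℕ) :
    quotπ (J ^ m) c.pt ≫ quotConeDesc hN c m = c.π.app (op m) :=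
  quotπ_quotDesc _ _ _

@[simp]
lemma quotπ_quotConeDesc_assoc (hN : IsAdicSystem J N) (c : Cone (N ⋙ Pro.of)) (m : ℕ) {Z : Pro C}
    (f : Pro.of.obj (N.obj (op m)) ⟶ Z) :
    quotπ (J ^ m) c.pt ≫ quotConeDesc hN c m ≫ f = c.π.app (op m) ≫ f :=
  quotπ_quotDesc_assoc _ _ _ _

/-- If `N_n ⟶ Z` is killed by `I` on the limit of the inverse system, then it is killed by `I` on
some `N_k`: each of the finitely many generators of `I` kills it far enough out. -/
lemma exists_smul_map_comp_eq_zero {c : Cone (N ⋙ Pro.of)} (hc : IsLimit c) {Z : C} {n : ℕ}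
    {I : Ideal R} {f : N.obj (op n) ⟶ Z}
    (hf : ∀ r ∈ I, r • (c.π.app (op n) ≫ Pro.of.map f) = 0) (m : ℕ) :
    ∃ (k : ℕ) (h : n ≤ k), m ≤ k ∧ ∀ r ∈ I, r • (N.map (homOfLE h).op ≫ f) = 0 := by
  have hgen : ∀ r ∈ gens I, ∀ᶠ k in Filter.atTop,
      ∀ h : n ≤ k, r • (N.map (homOfLE h).op ≫ f) = 0 := by
    intro r hr
    have h0 : c.π.app (op n) ≫ Pro.of.map (r • f) = c.π.app (op n) ≫ Pro.of.map 0 := by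
      rw [Pro.of_map_smul, Linear.comp_smul,
        hf r ((span_gens I).le (Ideal.subset_span hr)), Pro.of_map_zero R, comp_zero]
    obtain ⟨l, i, hi⟩ := Pro.exists_map_comp_eq hc h0
    filter_upwards [Filter.eventually_ge_atTop l.unop] with k hk h
    have h1 : N.map i ≫ (r • f) = 0 := by
      apply Pro.of.map_injective
      simpa only [Functor.comp_map, ← Functor.map_comp, comp_zero] using hi
    have h2 : (homOfLE h).op = (homOfLE hk).op ≫ i := rfl
    rw [h2, ← Linear.comp_smul, N.map_comp, Category.assoc, h1, comp_zero]
  obtain ⟨k, hk, hn, hm⟩ := (((Finset.eventually_all _).2 hgen).and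
    ((Filter.eventually_ge_atTop n).and (Filter.eventually_ge_atTop m))).exists
  refine ⟨k, hn, hm, fun r hr => ?_⟩
  rw [← span_gens I] at hr
  induction hr using Submodule.span_induction with
  | mem x hx => exact hk x hx hn
  | zero => rw [zero_smul]
  | add x y _ _ hx hy => rw [add_smul, hx, hy, add_zero]
  | smul a x _ hx => rw [smul_eq_mul, mul_smul, hx, smul_zero]

/-- If `L` is the limit of `(Nₙ)ₙ` in `Pro C`, then `L/LJᵐ ≅ N_m`. -/
lemma isIso_quotConeDesc (hN : IsAdicSystem J N) {c : Cone (N ⋙ Pro.of)} (hc : IsLimit c)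
    (m : ℕ) : IsIso (quotConeDesc hN c m) := by
  refine Pro.isIso_of_bijective _ fun Z => ⟨fun f g hfg => ?_, fun f => ?_⟩
  -- Injectivity: two maps that agree on `L` agree on some `N_k`, which maps epimorphically to `N_m`.
  · replace hfg : c.π.app (op m) ≫ f = c.π.app (op m) ≫ g := by
      simpa using quotπ (J ^ m) c.pt ≫= hfg
    obtain ⟨k, i, hi⟩ := Pro.exists_map_comp_eq hc hfg
    obtain ⟨f, rfl⟩ := Pro.of.map_surjective f
    obtain ⟨g, rfl⟩ := Pro.of.map_surjective g
    have : Epi (N.map i) := hN.epi_map (leOfHom i.unop)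
    congr 1
    rw [← cancel_epi (N.map i)]
    apply Pro.of.map_injective
    simpa using hi
  -- Surjectivity: the map `L ⟶ Z` comes from some `N_k` with `m ≤ k`, on which it is killed by `Jᵐ`
  -- once `k` is large, and then it factors through `N_m`.
  · obtain ⟨⟨n⟩, g, hg⟩ := Pro.exists_eq_π_comp hc (quotπ (J ^ m) c.pt ≫ f)
    obtain ⟨g, rfl⟩ := Pro.of.map_surjective g
    obtain ⟨k, h, hmk, hk⟩ := exists_smul_map_comp_eq_zero hc (I := J ^ m) (fun r hr => by
      rw [← hg, ← Linear.smul_comp, smul_quotπ _ hr, zero_comp]) m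
    obtain ⟨l, hl⟩ := hN.exists_eq_map_comp hmk _ hk
    refine ⟨Pro.of.map l, ?_⟩
    rw [← cancel_epi (quotπ (J ^ m) c.pt)]
    dsimp only
    rw [quotπ_quotConeDesc_assoc, hg, ← c.w (homOfLE hmk).op, ← c.w (homOfLE h).op]
    simp [← Functor.map_comp, hl]

lemma quotConeDesc_naturality (hN : IsAdicSystem J N) (c : Cone (N ⋙ Pro.of)) {m n : ℕ}
    (h : m ≤ n) :
    quotMap (Ideal.pow_le_pow_right h) (𝟙 c.pt) ≫ quotConeDesc hN c m =
      quotConeDesc hN c n ≫ Pro.of.map (N.map (homOfLE h).op) := by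
  rw [← cancel_epi (quotπ (J ^ n) c.pt)]
  simpa using (c.w (homOfLE h).op).symm

lemma quotMap_quotConeDesc {N' : ℕᵒᵖ ⥤ C} (hN : IsAdicSystem J N) (hN' : IsAdicSystem J N')
    (φ : N ⟶ N') {c : Cone (N ⋙ Pro.of)} {c' : Cone (N' ⋙ Pro.of)} (f : c.pt ⟶ c'.pt) (m : ℕ)
    (hf : f ≫ c'.π.app (op m) = c.π.app (op m) ≫ Pro.of.map (φ.app (op m))) :
    quotMap le_rfl f ≫ quotConeDesc hN' c' m =
      quotConeDesc hN c m ≫ Pro.of.map (φ.app (op m)) := by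
  rw [← cancel_epi (quotπ (J ^ m) c.pt), quotπ_quotMap_assoc, quotπ_quotConeDesc, hf,
    quotπ_quotConeDesc_assoc]

end Reduction

/-! ### The equivalence -/

section Equivalence

variable {R : Type w} [CommRing R] [IsNoetherianRing R] (J : Ideal R)
  (C : Type u) [Category.{v} C] [Abelian C] [Linear R C]

/-- The natural isomorphism `L/LJᵐ ≅ N_m`, where `L` is the limit of `(Nₙ)ₙ`. -/
def limProTowerIso : limPro J C ⋙ tower J ≅
    ObjectProperty.ι _ ⋙ (Functor.whiskeringRight _ _ _).obj Pro.of :=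
  NatIso.ofComponents
    (fun N => NatIso.ofComponents
      (fun m =>
        @asIso _ _ _ _ (quotConeDesc N.property (limit.cone (N.obj ⋙ Pro.of)) m.unop)
          (isIso_quotConeDesc N.property (limit.isLimit (N.obj ⋙ Pro.of)) m.unop))
      (fun i => quotConeDesc_naturality N.property (limit.cone _) (leOfHom i.unop)))
    (fun {N N'} f => by
      ext m
      exact quotMap_quotConeDesc N.property N'.property f.hom
        (limMap (Functor.whiskerRight f.hom Pro.of)) m.unop (limMap_π _ _))

/-- The canonical map `M ⟶ lim M/MJⁿ`. -/
def toLimTower (M : Pro C) : M ⟶ limit ((tower J).obj M) :=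
  limit.lift ((tower J).obj M) (towerCone J M)

lemma toLimTower_π (M : Pro C) (n : ℕᵒᵖ) :
    toLimTower J C M ≫ limit.π ((tower J).obj M) n = quotπ (J ^ n.unop) M :=
  limit.lift_π _ _

lemma toLimTower_naturality {M M' : Pro C} (f : M ⟶ M') :
    f ≫ toLimTower J C M' = toLimTower J C M ≫ limMap ((tower J).map f) := by
  apply limit.hom_ext
  intro n
  rw [Category.assoc, Category.assoc, limMap_π, toLimTower_π, ← Category.assoc, toLimTower_π]
  exact (quotπ_quotMap le_rfl f).symm

/-- The canonical map `L ⟶ lim L/LJⁿ` for `L = lim Nₙ` is inverse to the map that `L/LJⁿ ≅ N_n`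
induces on limits. -/
lemma toLimTower_limPro (N : AdicSystem J C) :
    toLimTower J C ((limPro J C).obj N) ≫ limMap ((limProTowerIso J C).hom.app N) = 𝟙 _ := by
  apply limit.hom_ext
  intro n
  erw [Category.assoc, limMap_π, ← Category.assoc, toLimTower_π, Category.id_comp]
  exact quotπ_quotConeDesc N.property (limit.cone (N.obj ⋙ Pro.of)) n.unop

/-- The limit in `Pro C` of a `J`-adic inverse system over `C` lies in the completion of `C`. -/
lemma isAdicallyComplete_limPro (N : AdicSystem J C) :
    IsAdicallyComplete J ((limPro J C).obj N) where
  quot_mem n := ⟨_, ⟨(((limProTowerIso J C).app N).app (op n)).symm⟩⟩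
  isIso := by
    have h : IsIso (toLimTower J C ((limPro J C).obj N) ≫
        limMap ((limProTowerIso J C).hom.app N)) := by
      rw [toLimTower_limPro]
      exact IsIso.id _
    have : IsIso (limMap ((limProTowerIso J C).hom.app N)) :=
      (lim.mapIso ((limProTowerIso J C).app N)).isIso_hom
    exact IsIso.of_isIso_comp_right (toLimTower J C ((limPro J C).obj N))
      (limMap ((limProTowerIso J C).hom.app N))

/-- The natural isomorphism `M ≅ lim M/MJⁿ` on the completion. -/
def completionIsoLim : ObjectProperty.ι (fun M : Pro C => IsAdicallyComplete J M) ≅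
    ObjectProperty.ι _ ⋙ tower J ⋙ lim :=
  NatIso.ofComponents
    (fun M => @asIso _ _ _ _ (toLimTower J C M.obj) M.property.isIso)
    (fun f => toLimTower_naturality J C f.hom)

/-- The natural isomorphism `M ≅ lim M/MJⁿ` on the completion, with values in the completion. -/
def unitIso : 𝟭 (Completion J C) ≅ sigma J C ⋙ psi J C (isAdicallyComplete_limPro J C) :=
  ((ObjectProperty.fullyFaithfulι _).whiskeringRight _).preimageIso
    (completionIsoLim J C ≪≫ Functor.isoWhiskerRight (towerCIso J C).symm lim)

/-- The natural isomorphism `(lim Nₙ)/(lim Nₙ)Jᵐ ≅ N_m` of inverse systems over `C`. -/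
def counitIso : psi J C (isAdicallyComplete_limPro J C) ⋙ sigma J C ≅ 𝟭 (AdicSystem J C) :=
  (((ObjectProperty.fullyFaithfulι _).comp
    ((Functor.FullyFaithful.ofFullyFaithful Pro.of).whiskeringRight _)).whiskeringRight
      _).preimageIso
    (Functor.isoWhiskerLeft (psi J C (isAdicallyComplete_limPro J C)) (towerCIso J C) ≪≫
      limProTowerIso J C)

end Equivalence

end JAdic

end

theorem proposition2p2p6 {R : Type w} [CommRing R] [IsNoetherianRing R] (J : Ideal R)
    (C : Type u) [Category.{v} C] [Abelian C] [Linear R C] [Noetherian.{v, u, v} C] :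
    ∃ (hΨ : ∀ N : JAdic.AdicSystem J C, JAdic.IsAdicallyComplete J ((JAdic.limPro J C).obj N))
      (e : JAdic.Completion J C ≌ JAdic.AdicSystem J C),
      e.functor = JAdic.sigma J C ∧ e.inverse = JAdic.psi J C hΨ :=
  ⟨_, CategoryTheory.Equivalence.mk (JAdic.sigma J C) (JAdic.psi J C _) (JAdic.unitIso J C)
    (JAdic.counitIso J C), rfl, rfl⟩
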